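/- Let $n,m$ be natural numbers and $\theta>0$. Equip the space of real $n\times m$ matrices with the trace inner product $\langle A,B\rangle=\operatorname{tr}(A^{T}B)$. Let $\|X\|_1=\sum_{i,j}|X_{i,j}|$ be the entrywise $\ell_1$-norm, let $\|X\|_*=\sum_i\sigma_i(X)$ be the nuclear norm (the sum of the singular values of $X$), and let $$\mathcal B_{1,*}=\{X\in\mathbb R^{n\times m} : \|X\|_1+\theta\|X\|_*\le 1\}$$ be the rank sparsity ball. Then $\mathcal B_{1,*}$ is facially exposed, meaning that every nonempty face of $\mathcal B_{1,*}$ is an exposed face. That is, for every nonempty convex set $F\subseteq\mathcal B_{1,*}$ such that each closed segment in $\mathcal B_{1,*}$ whose relative interior meets $F$ lies entirely in $F$, there is a matrix $V\in\mathbb R^{n\times m}$ with $$F=\operatorname*{argmax}\{\langle V,X\rangle : X\in\mathcal B_{1,*}\}.$$ -/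

import Mathlib

namespace RankSparsity

/-- The trace inner product `⟨A, B⟩ = tr (Aᵀ B)` on real `n × m` matrices. -/
def traceInner {n m : ℕ} (A B : Matrix (Fin n) (Fin m) ℝ) : ℝ :=
  (A.transpose * B).trace

/-- The singular values `σ₁(X) ≥ σ₂(X) ≥ ⋯` of a real `n × m` matrix, as a vector of length `n`
(indexed from zero; entries beyond the rank of `X` vanish). -/
noncomputable def singularValue {n m : ℕ} (X : Matrix (Fin n) (Fin m) ℝ) (i : Fin n) : ℝ :=
  (Matrix.toEuclideanLin X).singularValues i

/-- The entrywise `ℓ₁`-norm. -/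
def l1Norm {n m : ℕ} (X : Matrix (Fin n) (Fin m) ℝ) : ℝ :=
  ∑ i, ∑ j, |X i j|

/-- The nuclear norm, the sum of the singular values. -/
noncomputable def nuclearNorm {n m : ℕ} (X : Matrix (Fin n) (Fin m) ℝ) : ℝ :=
  ∑ i, singularValue X i

/-- The joint norm `‖X‖₁ + θ ‖X‖_*`. -/
noncomputable def jointNorm {n m : ℕ} (θ : ℝ) (X : Matrix (Fin n) (Fin m) ℝ) : ℝ :=
  l1Norm X + θ * nuclearNorm X

/-- The rank sparsity ball, the closed unit ball of the joint norm. -/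
def rankSparsityBall (n m : ℕ) (θ : ℝ) : Set (Matrix (Fin n) (Fin m) ℝ) :=
  {X | jointNorm θ X ≤ 1}

/-- `F` is a face of `Q`: a convex subset of `Q` such that every segment in `Q` whose relative
interior meets `F` lies in `F`. (In `IsExtreme` only the left endpoint is required to lie in `F`;
the right one follows by symmetry and the rest of the segment by convexity of `F`.) -/
def IsFace {E : Type*} [AddCommGroup E] [Module ℝ E] (Q F : Set E) : Prop :=
  Convex ℝ F ∧ IsExtreme ℝ Q F

/-- `F` is an exposed face of `Q`: it is the set of maximizers over `Q` of `X ↦ ⟨V, X⟩`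
for some exposing matrix `V`. -/
def IsExposedFace {n m : ℕ} (Q F : Set (Matrix (Fin n) (Fin m) ℝ)) : Prop :=
  ∃ V : Matrix (Fin n) (Fin m) ℝ,
    F = {X | X ∈ Q ∧ ∀ Y ∈ Q, traceInner V Y ≤ traceInner V X}

/-- `Q` is facially exposed: all of its (nonempty) faces are exposed. -/
def FaciallyExposed {n m : ℕ} (Q : Set (Matrix (Fin n) (Fin m) ℝ)) : Prop :=
  ∀ F : Set (Matrix (Fin n) (Fin m) ℝ), F.Nonempty → IsFace Q F → IsExposedFace Q F

end RankSparsity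

/-!
A face `F` of the unit ball of a sublinear function `N` has a relative interior point `x`, and `F`
is the smallest face containing `x`. If `N x < 1`, then `F` is the whole ball. If `N x = 1`, it
suffices to find a linear functional `v ≤ N` with `v x = N x` that touches `N` only at points `y`
for which `N (x - ε y) ≤ N x - ε N y` when `ε > 0` is small. For such a point with `N y = 1`, the
segment from `y` through `x` can be prolonged inside the ball, so `y ∈ F`; conversely every point of
`F` maximizes `v` because `x` is a relative interior point. Functionals of this kind are called
exposing here (`IsExposing`), and `IsFace.exists_eq_maximizers` is the argument just given.

The projection of a facially exposed set need not be facially exposed, and the unit ball of a sum of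
norms is of this nature, but exposing functionals do add: if `v₁ + v₂` touches `N₁ + N₂` at `y`, then
each `vᵢ` touches `Nᵢ` at `y`. It is therefore enough to treat the two summands separately.

* The `ℓ₁`-norm is a sum of absolute values of linear functionals, and `sign x` exposes the absolute
  value at `x`.
* For the nuclear norm, write `T = V P₀` with `P₀ = (Tᵀ T)^(1/2)` and `V` the partial isometry of the
  polar decomposition (`exists_isPolar`). The functional `X ↦ tr (Vᵀ X)` is exposing at `T`. It is
  bounded by the nuclear norm since `V` is a contraction (`traceFunctional_comp_le`). Equality at `X`
  forces `X = V P` with `P` positive and supported on the initial space of `V`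
  (`comp_eq_of_traceFunctional_comp_eq`). As `P₀` is positive definite on that space, `P₀ - ε P` is
  still positive for small `ε` (`eventually_isPositive_sub`), so the nuclear norm of
  `T - ε X = V (P₀ - ε P)` is at most `tr P₀ - ε tr P` (`opNuclearNorm_comp_le`).
-/

open Filter Topology InnerProductSpace Module

namespace RankSparsity

/-! ### Exposing functionals -/

section Exposing

variable {E E' : Type*} [AddCommGroup E] [Module ℝ E] [AddCommGroup E'] [Module ℝ E']

/-- The linear functional `v` supports `N` at `x`, and wherever it touches `N`, at `y` say, `N` grows
at the full rate when moving from `x - ε y` to `x` for small `ε > 0`. For sublinear `N` this says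
that `v` exposes the smallest face of the epigraph of `N` that contains `(x, N x)`. -/
structure IsExposing (N : E → ℝ) (x : E) (v : E →ₗ[ℝ] ℝ) : Prop where
  le : ∀ y, v y ≤ N y
  eq : v x = N x
  eventually_le : ∀ y, v y = N y → ∀ᶠ ε in 𝓝[>] (0 : ℝ), N (x - ε • y) ≤ N x - ε * N y

theorem IsExposing.zero (x : E) : IsExposing (fun _ => 0) x 0 :=
  ⟨fun _ => le_rfl, rfl, fun _ _ => by simp⟩

theorem IsExposing.add {N₁ N₂ : E → ℝ} {x : E} {v₁ v₂ : E →ₗ[ℝ] ℝ}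
    (h₁ : IsExposing N₁ x v₁) (h₂ : IsExposing N₂ x v₂) :
    IsExposing (fun y => N₁ y + N₂ y) x (v₁ + v₂) where
  le y := add_le_add (h₁.le y) (h₂.le y)
  eq := congrArg₂ (· + ·) h₁.eq h₂.eq
  eventually_le y hy := by
    have hy' : v₁ y + v₂ y = N₁ y + N₂ y := hy
    filter_upwards [h₁.eventually_le y (by linarith [h₁.le y, h₂.le y]),
      h₂.eventually_le y (by linarith [h₁.le y, h₂.le y])] with ε h h'
    linarith

theorem IsExposing.const_mul {N : E → ℝ} {x : E} {v : E →ₗ[ℝ] ℝ} (h : IsExposing N x v)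
    {c : ℝ} (hc : 0 < c) : IsExposing (fun y => c * N y) x (c • v) where
  le y := mul_le_mul_of_nonneg_left (h.le y) hc.le
  eq := congrArg (c * ·) h.eq
  eventually_le y hy := by
    filter_upwards [h.eventually_le y (mul_left_cancel₀ hc.ne' hy)] with ε h
    nlinarith

theorem IsExposing.sum {ι : Type*} (s : Finset ι) {N : ι → E → ℝ} {x : E}
    {v : ι → E →ₗ[ℝ] ℝ} (h : ∀ i, IsExposing (N i) x (v i)) :
    IsExposing (fun y => ∑ i ∈ s, N i y) x (∑ i ∈ s, v i) := by
  classical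
  induction s using Finset.induction_on with
  | empty => simpa using IsExposing.zero x
  | insert i s hi ih => simpa [Finset.sum_insert hi] using (h i).add ih

theorem IsExposing.comp {N : E' → ℝ} (L : E →ₗ[ℝ] E') {x : E} {v : E' →ₗ[ℝ] ℝ}
    (h : IsExposing N (L x) v) : IsExposing (fun y => N (L y)) x (v ∘ₗ L) where
  le y := h.le (L y)
  eq := h.eq
  eventually_le y hy := by simpa using h.eventually_le (L y) hy

/-- At `x = 0` the exposing functional is zero, which touches the absolute value only at the
origin. -/
theorem isExposing_abs (x : ℝ) :
    IsExposing (fun y : ℝ => |y|) x ((SignType.sign x : ℝ) • LinearMap.id) where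
  le y := by
    rcases lt_trichotomy x 0 with h | h | h
    · simpa [h] using neg_le_abs y
    · simp [h]
    · simpa [h] using le_abs_self y
  eq := by simp
  eventually_le y hy := by
    have hlim : Tendsto (fun ε : ℝ => x - ε • y) (𝓝[>] 0) (𝓝 x) := by
      have : Tendsto (fun ε : ℝ => x - ε • y) (𝓝 0) (𝓝 (x - (0 : ℝ) • y)) :=
        Continuous.tendsto (by fun_prop) 0
      simpa using this.mono_left nhdsWithin_le_nhds
    rcases lt_trichotomy x 0 with h | h | h
    · filter_upwards [hlim.eventually (gt_mem_nhds h)] with ε hε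
      simp only [sign_neg h, SignType.coe_neg, SignType.coe_one, LinearMap.smul_apply,
        LinearMap.id_apply, smul_eq_mul] at hy hε ⊢
      rw [abs_of_neg hε, abs_of_neg h, ← hy]
      linarith
    · have : y = 0 := by simpa [h, eq_comm] using hy
      simp [h, this]
    · filter_upwards [hlim.eventually (lt_mem_nhds h)] with ε hε
      simp only [sign_pos h, SignType.coe_one, LinearMap.smul_apply,
        LinearMap.id_apply, smul_eq_mul] at hy hε ⊢
      rw [abs_of_pos hε, abs_of_pos h, ← hy]
      linarith

/-- A function with a supporting linear functional at every point is subadditive. -/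
theorem add_le_of_exists_isExposing {N : E → ℝ} (hN : ∀ x, ∃ v, IsExposing N x v) (x y : E) :
    N (x + y) ≤ N x + N y := by
  obtain ⟨v, hv⟩ := hN (x + y)
  rw [← hv.eq, map_add]
  exact add_le_add (hv.le x) (hv.le y)

/-- A function with a supporting linear functional at every point is positively subhomogeneous. -/
theorem smul_le_of_exists_isExposing {N : E → ℝ} (hN : ∀ x, ∃ v, IsExposing N x v)
    {c : ℝ} (hc : 0 ≤ c) (x : E) : N (c • x) ≤ c * N x := by
  obtain ⟨v, hv⟩ := hN (c • x)
  rw [← hv.eq, map_smul]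
  exact mul_le_mul_of_nonneg_left (hv.le x) hc

end Exposing

/-! ### Faces of the unit ball -/

section Faces

variable {E : Type*} [NormedAddCommGroup E] [NormedSpace ℝ E]

/-- A segment of `s` that ends at a relative interior point can be prolonged beyond it. -/
theorem exists_add_smul_sub_mem_of_mem_intrinsicInterior {s : Set E} {x y : E}
    (hx : x ∈ intrinsicInterior ℝ s) (hy : y ∈ s) : ∃ ε > (0 : ℝ), x + ε • (x - y) ∈ s := by
  obtain ⟨z, hz, rfl⟩ := mem_intrinsicInterior.1 hx
  have hy' := subset_affineSpan ℝ s hy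
  let γ : ℝ → affineSpan ℝ s := fun ε =>
    ⟨AffineMap.lineMap (z : E) y (-ε), AffineMap.lineMap_mem _ z.2 hy'⟩
  have hγ : Continuous γ :=
    Continuous.subtype_mk (AffineMap.lineMap_continuous.comp continuous_neg) _
  have hγ0 : γ 0 = z := Subtype.ext (by simp [γ])
  have hev : ∀ᶠ ε in 𝓝[>] (0 : ℝ), (γ ε : E) ∈ s := by
    have := hγ.tendsto 0
    rw [hγ0] at this
    exact (this.mono_left nhdsWithin_le_nhds).eventually (mem_interior_iff_mem_nhds.1 hz)
  obtain ⟨ε, hε, hpos⟩ := (hev.and self_mem_nhdsWithin).exists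
  refine ⟨ε, hpos, ?_⟩
  convert hε using 1
  simp only [γ, AffineMap.lineMap_apply, vsub_eq_sub, vadd_eq_add]
  module

theorem mem_openSegment_add_smul_sub (x y : E) {ε : ℝ} (hε : 0 < ε) :
    x ∈ openSegment ℝ y (x + ε • (x - y)) := by
  refine ⟨ε / (1 + ε), 1 / (1 + ε), by positivity, by positivity, by field_simp; ring, ?_⟩
  match_scalars <;> field_simp; ring

/-- If `N` has an exposing functional at every point, then the unit ball of `N` is facially
exposed. A proper face is exposed by the functional belonging to one of its relative interior
points, the ball itself by the zero functional. -/
theorem IsFace.exists_eq_maximizers [FiniteDimensional ℝ E] {N : E → ℝ}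
    (hN : ∀ x, ∃ v, IsExposing N x v) {F : Set E} (hne : F.Nonempty)
    (hF : IsFace {x | N x ≤ 1} F) :
    ∃ v : E →ₗ[ℝ] ℝ, F = {x | x ∈ {x | N x ≤ 1} ∧ ∀ y ∈ {x | N x ≤ 1}, v y ≤ v x} := by
  obtain ⟨hconv, hext⟩ := hF
  obtain ⟨x, hx⟩ := hne.intrinsicInterior hconv
  have hxF := intrinsicInterior_subset hx
  have hx1 : N x ≤ 1 := hext.subset hxF
  rcases hx1.lt_or_eq with hlt | heq
  · -- Below level one, `x` is interior to the ball, so the segment from any `y` in the ball through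
    -- `x` can be prolonged inside the ball.
    refine ⟨0, Set.Subset.antisymm (fun y hy => ⟨hext.subset hy, by simp⟩) fun y hy => ?_⟩
    set ε : ℝ := (1 - N x) / (|N (x - y)| + 1) with hεdef
    have hε : 0 < ε := div_pos (by linarith) (by positivity)
    refine hext.left_mem_of_mem_openSegment hy.1 ?_ hxF (mem_openSegment_add_smul_sub x y hε)
    have h₁ := add_le_of_exists_isExposing hN x (ε • (x - y))
    have h₂ := smul_le_of_exists_isExposing hN hε.le (x - y)
    have h₃ : ε * (|N (x - y)| + 1) = 1 - N x := div_mul_cancel₀ _ (by positivity)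
    have h₄ : ε * N (x - y) ≤ ε * |N (x - y)| :=
      mul_le_mul_of_nonneg_left (le_abs_self _) hε.le
    change N _ ≤ 1
    linarith
  · obtain ⟨v, hv⟩ := hN x
    have hvx : v x = 1 := hv.eq.trans heq
    have hle : ∀ y, N y ≤ 1 → v y ≤ 1 := fun y hy => (hv.le y).trans hy
    refine ⟨v, Set.Subset.antisymm (fun y hy => ?_) fun y hy => ?_⟩
    · refine ⟨hext.subset hy, fun z hz => (hle z hz).trans ?_⟩
      obtain ⟨ε, hε, hmem⟩ := exists_add_smul_sub_mem_of_mem_intrinsicInterior hx hy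
      have h := hle _ (hext.subset hmem)
      -- The prolonged point has value `1 + ε (1 - v y) ≤ 1`, hence `v y ≥ 1`.
      simp only [map_add, map_smul, map_sub, smul_eq_mul, hvx] at h
      nlinarith
    · have hvy : 1 ≤ v y := hvx ▸ hy.2 x hx1
      have hNy : N y = 1 := le_antisymm hy.1 (hvy.trans (hv.le y))
      have hvy1 : v y = N y := le_antisymm (hv.le y) (hNy ▸ hvy)
      obtain ⟨ε, hεN, hε, hε1⟩ := ((hv.eventually_le y hvy1).and
        (Ioo_mem_nhdsGT (zero_lt_one' ℝ))).exists
      -- `x = ε y + (1 - ε) z` with `z = (1 - ε)⁻¹ (x - ε y)` in the ball.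
      have hε' : 0 < 1 - ε := by linarith
      refine hext.left_mem_of_mem_openSegment hy.1 (y := (1 - ε)⁻¹ • (x - ε • y)) ?_ hxF
        ⟨ε, 1 - ε, hε, hε', by ring, ?_⟩
      · refine (smul_le_of_exists_isExposing hN (inv_nonneg.2 hε'.le) _).trans ?_
        rw [heq, hNy] at hεN
        rw [inv_mul_le_iff₀ hε']
        linarith
      · rw [smul_inv_smul₀ hε'.ne']
        module

end Faces

/-! ### The nuclear norm -/

section Nuclear

variable {E F : Type*} [NormedAddCommGroup E] [InnerProductSpace ℝ E]
  [NormedAddCommGroup F] [InnerProductSpace ℝ F]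

theorem trace_eq_sum_of_apply_eq_smul {P : E →ₗ[ℝ] E} {ι : Type*} [Fintype ι]
    (b : OrthonormalBasis ι ℝ E) (p : ι → ℝ) (hP : ∀ i, P (b i) = p i • b i) :
    LinearMap.trace ℝ E P = ∑ i, p i := by
  rw [LinearMap.trace_eq_sum_inner _ b]
  simp [hP, inner_smul_right]

theorem real_inner_le_one_of_contraction {V W : E →ₗ[ℝ] F} (hV : ∀ x, ‖V x‖ ≤ ‖x‖)
    (hW : ∀ x, ‖W x‖ ≤ ‖x‖) {x : E} (hx : ‖x‖ = 1) : ⟪V x, W x⟫_ℝ ≤ 1 :=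
  (real_inner_le_norm _ _).trans <| mul_le_one₀ (hx ▸ hV x) (norm_nonneg _) (hx ▸ hW x)

variable [FiniteDimensional ℝ E] [FiniteDimensional ℝ F]

/-- The nuclear norm of a linear map, with one singular value for each dimension of the domain. -/
noncomputable def opNuclearNorm (T : E →ₗ[ℝ] F) : ℝ :=
  ∑ i : Fin (finrank ℝ E), T.singularValues i

/-- Singular values beyond the rank vanish, so any sum of at least rank-many of them is the nuclear
norm. This allows a matrix to be given as many singular values as it has rows, although the domain
of its linear map is indexed by the columns. -/
theorem sum_singularValues_eq_of_finrank_range_le (T : E →ₗ[ℝ] F) {k : ℕ}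
    (hk : finrank ℝ T.range ≤ k) : ∑ i : Fin k, T.singularValues i = opNuclearNorm T := by
  have h : ∀ l, finrank ℝ T.range ≤ l →
      ∑ i : Fin l, T.singularValues i = ∑ i ∈ T.singularValues.support, T.singularValues i := by
    intro l hl
    rw [Fin.sum_univ_eq_sum_range (fun i => T.singularValues i) l]
    refine (Finset.sum_subset ?_ fun i _ hi => Finsupp.notMem_support_iff.1 hi).symm
    rw [T.support_singularValues]
    exact Finset.range_mono hl
  rw [opNuclearNorm, h k hk, h _ (LinearMap.finrank_range_le T)]

/-- The functional `T ↦ tr (Vᵀ T)`. -/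
noncomputable def traceFunctional (V : E →ₗ[ℝ] F) : (E →ₗ[ℝ] F) →ₗ[ℝ] ℝ :=
  LinearMap.trace ℝ E ∘ₗ LinearMap.llcomp ℝ E F E V.adjoint

theorem traceFunctional_apply (V T : E →ₗ[ℝ] F) :
    traceFunctional V T = LinearMap.trace ℝ E (V.adjoint ∘ₗ T) := rfl

theorem norm_adjoint_apply_le {V : E →ₗ[ℝ] F} (hV : ∀ x, ‖V x‖ ≤ ‖x‖) (y : F) :
    ‖V.adjoint y‖ ≤ ‖y‖ := by
  have h : ‖V.adjoint y‖ * ‖V.adjoint y‖ ≤ ‖y‖ * ‖V.adjoint y‖ := by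
    rw [← real_inner_self_eq_norm_mul_norm, LinearMap.adjoint_inner_left]
    exact (real_inner_le_norm _ _).trans (mul_le_mul_of_nonneg_left (hV _) (norm_nonneg _))
  rcases (norm_nonneg (V.adjoint y)).eq_or_lt with h0 | h0
  · rw [← h0]; exact norm_nonneg _
  · exact le_of_mul_le_mul_right h h0

theorem adjoint_apply_self_of_norm_eq {V : E →ₗ[ℝ] F} (hV : ∀ x, ‖V x‖ ≤ ‖x‖) {x : E}
    (hx : ‖V x‖ = ‖x‖) : V.adjoint (V x) = x := by
  have h₁ := norm_adjoint_apply_le hV (V x)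
  have h₂ : ⟪V.adjoint (V x), x⟫_ℝ = ‖x‖ ^ 2 := by
    rw [LinearMap.adjoint_inner_left, real_inner_self_eq_norm_sq, hx]
  have h₃ := norm_sub_sq_real (V.adjoint (V x)) x
  rw [h₂] at h₃
  rw [hx] at h₁
  have h₄ : ‖V.adjoint (V x)‖ ^ 2 ≤ ‖x‖ ^ 2 := pow_le_pow_left₀ (norm_nonneg _) h₁ 2
  have h₅ : ‖V.adjoint (V x) - x‖ ^ 2 = 0 := le_antisymm (by linarith) (sq_nonneg _)
  exact sub_eq_zero.1 (norm_eq_zero.1 (pow_eq_zero_iff two_ne_zero |>.1 h₅))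

theorem trace_adjoint_comp_comp (V W : E →ₗ[ℝ] F) {P : E →ₗ[ℝ] E} {ι : Type*} [Fintype ι]
    (b : OrthonormalBasis ι ℝ E) (p : ι → ℝ) (hP : ∀ i, P (b i) = p i • b i) :
    traceFunctional V (W ∘ₗ P) = ∑ i, p i * ⟪V (b i), W (b i)⟫_ℝ := by
  rw [traceFunctional_apply, LinearMap.trace_eq_sum_inner _ b]
  refine Finset.sum_congr rfl fun i _ => ?_
  simp [hP, LinearMap.adjoint_inner_right, inner_smul_right]

theorem exists_orthonormalBasis_of_isPositive {P : E →ₗ[ℝ] E} (hP : P.IsPositive) :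
    ∃ (b : OrthonormalBasis (Fin (finrank ℝ E)) ℝ E) (p : Fin (finrank ℝ E) → ℝ),
      (∀ i, 0 ≤ p i) ∧ ∀ i, P (b i) = p i • b i :=
  ⟨hP.isSymmetric.eigenvectorBasis rfl, hP.isSymmetric.eigenvalues rfl,
    hP.nonneg_eigenvalues rfl, fun i =>
      hP.isSymmetric.apply_eigenvectorBasis rfl i⟩

/-- With `W P` the polar decomposition of an arbitrary map, this is the inequality
`tr (Vᵀ X) ≤ ‖X‖_*` for contractions `V`. -/
theorem traceFunctional_comp_le {V W : E →ₗ[ℝ] F} (hV : ∀ x, ‖V x‖ ≤ ‖x‖)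
    (hW : ∀ x, ‖W x‖ ≤ ‖x‖) {P : E →ₗ[ℝ] E} (hP : P.IsPositive) :
    traceFunctional V (W ∘ₗ P) ≤ LinearMap.trace ℝ E P := by
  obtain ⟨b, p, hp, hb⟩ := exists_orthonormalBasis_of_isPositive hP
  rw [trace_adjoint_comp_comp V W b p hb, trace_eq_sum_of_apply_eq_smul b p hb]
  exact Finset.sum_le_sum fun i _ => mul_le_of_le_one_right (hp i)
    (real_inner_le_one_of_contraction hV hW (b.norm_eq_one i))

/-- In the equality case of `traceFunctional_comp_le`, the contraction `V` agrees with `W` and is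
isometric on the eigenvectors of `P` with nonzero eigenvalue. -/
theorem comp_eq_of_traceFunctional_comp_eq {V W : E →ₗ[ℝ] F} (hV : ∀ x, ‖V x‖ ≤ ‖x‖)
    (hW : ∀ x, ‖W x‖ ≤ ‖x‖) {P : E →ₗ[ℝ] E} (hP : P.IsPositive)
    (h : traceFunctional V (W ∘ₗ P) = LinearMap.trace ℝ E P) :
    V ∘ₗ P = W ∘ₗ P ∧ V.adjoint ∘ₗ V ∘ₗ P = P := by
  obtain ⟨b, p, hp, hb⟩ := exists_orthonormalBasis_of_isPositive hP
  rw [trace_adjoint_comp_comp V W b p hb, trace_eq_sum_of_apply_eq_smul b p hb,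
    Finset.sum_eq_sum_iff_of_le fun i _ => mul_le_of_le_one_right (hp i)
      (real_inner_le_one_of_contraction hV hW (b.norm_eq_one i))] at h
  have key : ∀ i, p i = 0 ∨ V (b i) = W (b i) ∧ V.adjoint (V (b i)) = b i := by
    intro i
    refine or_iff_not_imp_left.2 fun h0 => ?_
    have h1 : ⟪V (b i), W (b i)⟫_ℝ = 1 := by
      simpa [h0] using h i (Finset.mem_univ i)
    have hVi : ‖V (b i)‖ ≤ 1 := b.norm_eq_one i ▸ hV (b i)
    have hWi : ‖W (b i)‖ ≤ 1 := b.norm_eq_one i ▸ hW (b i)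
    have hle : 1 ≤ ‖V (b i)‖ * ‖W (b i)‖ := h1 ▸ real_inner_le_norm _ _
    have hV1 : ‖V (b i)‖ = 1 := le_antisymm hVi
      (hle.trans (mul_le_of_le_one_right (norm_nonneg _) hWi))
    have hW1 : ‖W (b i)‖ = 1 := le_antisymm hWi
      (hle.trans (mul_le_of_le_one_left (norm_nonneg _) hVi))
    exact ⟨(inner_eq_one_iff_of_norm_eq_one hV1 hW1).1 h1,
      adjoint_apply_self_of_norm_eq hV (hV1.trans (b.norm_eq_one i).symm)⟩
  constructor <;> refine b.toBasis.ext fun i => ?_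
  · rcases key i with h0 | ⟨h0, -⟩ <;> simp [hb, h0]
  · rcases key i with h0 | ⟨-, h0⟩ <;> simp [hb, h0]

/-- Right singular vectors: an orthonormal basis that `T` maps to orthogonal vectors whose lengths
are the singular values. -/
theorem exists_orthonormalBasis_inner_eq_sq (T : E →ₗ[ℝ] F) :
    ∃ (b : OrthonormalBasis (Fin (finrank ℝ E)) ℝ E) (σ : Fin (finrank ℝ E) → ℝ),
      (∀ i, 0 ≤ σ i) ∧ (∀ i j, ⟪T (b i), T (b j)⟫_ℝ = if i = j then σ i ^ 2 else 0) ∧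
      ∑ i, σ i = opNuclearNorm T := by
  have hs := T.isSymmetric_adjoint_comp_self
  refine ⟨hs.eigenvectorBasis rfl, fun i => T.singularValues i,
    fun i => T.singularValues_nonneg i, fun i j => ?_, rfl⟩
  rw [← LinearMap.adjoint_inner_left, ← LinearMap.comp_apply, hs.apply_eigenvectorBasis rfl i,
    T.sq_singularValues_fin rfl, inner_smul_left,
    orthonormal_iff_ite.1 (hs.eigenvectorBasis rfl).orthonormal]
  simp

/-- `T = V P` is the polar decomposition of `T`: `V` is a contraction, isometric on the range of the
positive map `P`, and the trace of `P` is the nuclear norm of `T`. The last field expresses that `V`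
vanishes on the kernel of `P`, in the quantitative form that `P` dominates a positive multiple of
`Vᵀ V`. -/
structure IsPolar (T V : E →ₗ[ℝ] F) (P : E →ₗ[ℝ] E) : Prop where
  contraction : ∀ x, ‖V x‖ ≤ ‖x‖
  isPositive : P.IsPositive
  comp_eq : V ∘ₗ P = T
  adjoint_comp : V.adjoint ∘ₗ V ∘ₗ P = P
  trace_eq : LinearMap.trace ℝ E P = opNuclearNorm T
  coercive : ∃ c > 0, ∀ x, c * ‖V x‖ ^ 2 ≤ ⟪P x, x⟫_ℝ

theorem exists_isPolar (T : E →ₗ[ℝ] F) : ∃ V P, IsPolar T V P := by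
  obtain ⟨b, σ, hσ, hT, hsum⟩ := exists_orthonormalBasis_inner_eq_sq T
  -- The inverse is zero when `σ i = 0`, so that `V` vanishes on the kernel of `T`.
  let V : E →ₗ[ℝ] F := b.toBasis.constr ℝ fun i => (σ i)⁻¹ • T (b i)
  let P : E →ₗ[ℝ] E := b.toBasis.constr ℝ fun i => σ i • b i
  have hVb : ∀ i, V (b i) = (σ i)⁻¹ • T (b i) := fun i => by
    rw [← b.coe_toBasis, b.toBasis.constr_basis ℝ, b.coe_toBasis]
  have hPb : ∀ i, P (b i) = σ i • b i := fun i => by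
    rw [← b.coe_toBasis, b.toBasis.constr_basis ℝ, b.coe_toBasis]
  have hT0 : ∀ i, σ i = 0 → T (b i) = 0 := fun i h => by
    have := hT i i
    rwa [if_pos rfl, h, zero_pow two_ne_zero, inner_self_eq_zero] at this
  have hVV : ∀ i j, ⟪V (b i), V (b j)⟫_ℝ = if i = j then (if σ i = 0 then 0 else 1) else 0 := by
    intro i j
    rw [hVb, hVb, inner_smul_left, inner_smul_right, hT]
    split_ifs with hij h0
    · simp [h0]
    · subst hij
      simp only [conj_trivial]
      field_simp
    · simp
  have hVx : ∀ x, ‖V x‖ ^ 2 = ∑ i, (if σ i = 0 then 0 else 1) * ⟪b i, x⟫_ℝ ^ 2 := by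
    intro x
    conv_lhs => rw [← b.sum_repr' x]
    rw [← real_inner_self_eq_norm_sq, map_sum, sum_inner]
    refine Finset.sum_congr rfl fun i _ => ?_
    rw [inner_sum, Finset.sum_eq_single i]
    · rw [map_smul, inner_smul_left, inner_smul_right, hVV, if_pos rfl]
      simp only [conj_trivial]
      ring
    · intro j _ hj
      rw [map_smul, map_smul, inner_smul_left, inner_smul_right, hVV, if_neg hj.symm]
      simp
    · simp
  have hPx : ∀ x y, ⟪P x, y⟫_ℝ = ∑ i, σ i * (⟪b i, x⟫_ℝ * ⟪b i, y⟫_ℝ) := by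
    intro x y
    conv_lhs => rw [← b.sum_repr' x]
    rw [map_sum, sum_inner]
    refine Finset.sum_congr rfl fun i _ => ?_
    rw [map_smul, hPb, inner_smul_left, inner_smul_left]
    simp only [conj_trivial]
    ring
  have hV : ∀ x, ‖V x‖ ≤ ‖x‖ := fun x => by
    refine le_of_sq_le_sq ?_ (norm_nonneg x)
    rw [hVx, ← b.sum_sq_inner_right x]
    refine Finset.sum_le_sum fun i _ => mul_le_of_le_one_left (sq_nonneg _) ?_
    split_ifs <;> norm_num
  refine ⟨V, P, ⟨hV, ⟨fun x y => ?_, fun x => ?_⟩, ?_, ?_, ?_, ?_⟩⟩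
  · rw [hPx, real_inner_comm, hPx]
    exact Finset.sum_congr rfl fun i _ => by ring
  · rw [hPx, RCLike.re_to_real]
    exact Finset.sum_nonneg fun i _ => mul_nonneg (hσ i) (mul_self_nonneg _)
  · refine b.toBasis.ext fun i => ?_
    by_cases h : σ i = 0
    · simp [hPb, h, hT0]
    · simp [hPb, hVb, h]
  · refine b.toBasis.ext fun i => ?_
    by_cases h : σ i = 0
    · simp [hPb, h]
    · have h1 : ‖V (b i)‖ = ‖b i‖ := by
        rw [← sq_eq_sq₀ (norm_nonneg _) (norm_nonneg _), ← real_inner_self_eq_norm_sq, hVV,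
          if_pos rfl, if_neg h, b.norm_eq_one, one_pow]
      simp [hPb, adjoint_apply_self_of_norm_eq hV h1]
  · rw [trace_eq_sum_of_apply_eq_smul b σ hPb, hsum]
  · obtain ⟨c, hc, hcσ⟩ : ∃ c > 0, ∀ i, σ i ≠ 0 → c ≤ σ i := by
      have : ∀ᶠ c in 𝓝[>] (0 : ℝ), ∀ i, σ i ≠ 0 → c ≤ σ i := by
        refine eventually_all.2 fun i => ?_
        by_cases h : σ i = 0
        · simp [h]
        · filter_upwards [Ioo_mem_nhdsGT ((hσ i).lt_of_ne' h)] with c hc _ using hc.2.le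
      obtain ⟨c, hc, hpos⟩ := (this.and self_mem_nhdsWithin).exists
      exact ⟨c, hpos, hc⟩
    refine ⟨c, hc, fun x => ?_⟩
    rw [hVx, hPx, Finset.mul_sum]
    refine Finset.sum_le_sum fun i _ => ?_
    rw [← pow_two, ← mul_assoc]
    refine mul_le_mul_of_nonneg_right ?_ (sq_nonneg _)
    split_ifs with h
    · simp [h]
    · simpa using hcσ i h

/-- Duality bounds the nuclear norm from above: if `W R` is the polar decomposition of `V Q`, then
`‖V Q‖_* = tr R = tr (Wᵀ V Q) ≤ tr Q`. -/
theorem opNuclearNorm_comp_le {V : E →ₗ[ℝ] F} (hV : ∀ x, ‖V x‖ ≤ ‖x‖) {Q : E →ₗ[ℝ] E}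
    (hQ : Q.IsPositive) : opNuclearNorm (V ∘ₗ Q) ≤ LinearMap.trace ℝ E Q := by
  obtain ⟨W, R, h⟩ := exists_isPolar (V ∘ₗ Q)
  rw [← h.trace_eq, ← h.adjoint_comp, h.comp_eq]
  exact traceFunctional_comp_le h.contraction hV hQ

/-- A positive map `P` supported on the initial space of `V` satisfies `P ≤ C Vᵀ V` for some `C`,
whereas `c Vᵀ V ≤ P₀`, so `P₀ - ε P` is positive as soon as `ε C < c`. -/
theorem eventually_isPositive_sub {V : E →ₗ[ℝ] F} {P₀ P : E →ₗ[ℝ] E} (hP₀ : P₀.IsPositive)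
    (hP : P.IsPositive) (hVP : V.adjoint ∘ₗ V ∘ₗ P = P) {c : ℝ} (hc : 0 < c)
    (hcP : ∀ x, c * ‖V x‖ ^ 2 ≤ ⟪P₀ x, x⟫_ℝ) :
    ∀ᶠ ε in 𝓝[>] (0 : ℝ), (P₀ - ε • P).IsPositive := by
  -- The adjoint of the identity `Vᵀ V P = P`.
  have hPV : ∀ x, P (V.adjoint (V x)) = P x := fun x => ext_inner_right ℝ fun y => by
    rw [hP.isSymmetric, LinearMap.adjoint_inner_left, ← LinearMap.adjoint_inner_right,
      hP.isSymmetric]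
    exact congrArg (fun A : E →ₗ[ℝ] E => ⟪x, A y⟫_ℝ) hVP
  -- As `P = Vᵀ (V P Vᵀ) V`, the constant `C` can be the operator norm of `V P Vᵀ`.
  let A : F →L[ℝ] F := (V ∘ₗ P ∘ₗ V.adjoint).toContinuousLinearMap
  have hA : ∀ x, ⟪P x, x⟫_ℝ ≤ ‖A‖ * ‖V x‖ ^ 2 := by
    intro x
    have h : ⟪P x, x⟫_ℝ = ⟪A (V x), V x⟫_ℝ := by
      change _ = ⟪V (P (V.adjoint (V x))), V x⟫_ℝ
      rw [hPV, ← LinearMap.adjoint_inner_left]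
      exact congrArg (fun A : E →ₗ[ℝ] E => ⟪A x, x⟫_ℝ) hVP.symm
    rw [h]
    refine (real_inner_le_norm _ _).trans ?_
    rw [pow_two, ← mul_assoc]
    exact mul_le_mul_of_nonneg_right (A.le_opNorm _) (norm_nonneg _)
  have hlim : Tendsto (fun ε : ℝ => ε * ‖A‖) (𝓝[>] 0) (𝓝 0) := by
    have : Tendsto (fun ε : ℝ => ε * ‖A‖) (𝓝 0) (𝓝 (0 * ‖A‖)) :=
      Continuous.tendsto (by fun_prop) 0
    simpa using this.mono_left nhdsWithin_le_nhds
  filter_upwards [hlim.eventually (gt_mem_nhds hc), self_mem_nhdsWithin] with ε hεc hε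
  refine ⟨hP₀.isSymmetric.sub (hP.isSymmetric.smul (conj_trivial ε)), fun x => ?_⟩
  have h₁ := mul_le_mul_of_nonneg_left (hA x) (le_of_lt hε)
  have h₂ := mul_le_mul_of_nonneg_right hεc.le (sq_nonneg ‖V x‖)
  simp only [LinearMap.sub_apply, LinearMap.smul_apply, inner_sub_left, inner_smul_left,
    conj_trivial, RCLike.re_to_real]
  linarith [hcP x]

/-- The nuclear norm is exposed at `T = V P₀` by the functional `X ↦ tr (Vᵀ X)`. -/
theorem exists_isExposing_opNuclearNorm (T : E →ₗ[ℝ] F) :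
    ∃ v, IsExposing opNuclearNorm T v := by
  obtain ⟨V, P₀, h₀⟩ := exists_isPolar T
  refine ⟨traceFunctional V, fun X => ?_, ?_, fun X hX => ?_⟩
  · obtain ⟨W, P, h⟩ := exists_isPolar X
    rw [← h.trace_eq, ← h.comp_eq]
    exact traceFunctional_comp_le h₀.contraction h.contraction h.isPositive
  · rw [← h₀.trace_eq, traceFunctional_apply]
    conv_lhs => rw [← h₀.comp_eq]
    rw [h₀.adjoint_comp]
  · obtain ⟨W, P, h⟩ := exists_isPolar X
    have hX' := hX
    rw [← h.trace_eq, ← h.comp_eq] at hX'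
    obtain ⟨hVW, hVP⟩ :=
      comp_eq_of_traceFunctional_comp_eq h₀.contraction h.contraction h.isPositive hX'
    obtain ⟨c, hc, hcP⟩ := h₀.coercive
    filter_upwards [eventually_isPositive_sub h₀.isPositive h.isPositive hVP hc hcP] with ε hε
    have hTX : T - ε • X = V ∘ₗ (P₀ - ε • P) := by
      rw [LinearMap.comp_sub, LinearMap.comp_smul, h₀.comp_eq, hVW, h.comp_eq]
    rw [hTX, ← h₀.trace_eq, ← h.trace_eq]
    simpa using opNuclearNorm_comp_le h₀.contraction hε

end Nuclear

/-! ### The joint norm -/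

/-- Both summands of the joint norm have exposing functionals, and these add up. -/
theorem exists_isExposing_jointNorm {n m : ℕ} {θ : ℝ} (hθ : 0 < θ)
    (X : Matrix (Fin n) (Fin m) ℝ) : ∃ v, IsExposing (jointNorm θ) X v := by
  have hnuc : (fun Y : Matrix (Fin n) (Fin m) ℝ => nuclearNorm Y) =
      fun Y => opNuclearNorm ((Matrix.toEuclideanLin (𝕜 := ℝ)).toLinearMap Y) := by
    funext Y
    refine sum_singularValues_eq_of_finrank_range_le _ ?_
    simpa using Submodule.finrank_le (LinearMap.range (Matrix.toEuclideanLin Y))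
  obtain ⟨w, hw⟩ := exists_isExposing_opNuclearNorm
    ((Matrix.toEuclideanLin (𝕜 := ℝ)).toLinearMap X)
  have h₂ := hw.comp
  rw [← hnuc] at h₂
  exact ⟨_, (IsExposing.sum Finset.univ fun i => IsExposing.sum Finset.univ fun j =>
    (isExposing_abs (X i j)).comp (Matrix.entryLinearMap ℝ ℝ i j)).add (h₂.const_mul hθ)⟩

/-- Every linear functional on matrices is represented by the trace inner product. -/
theorem exists_traceInner_eq {n m : ℕ} (v : Matrix (Fin n) (Fin m) ℝ →ₗ[ℝ] ℝ) :
    ∃ V : Matrix (Fin n) (Fin m) ℝ, ∀ X, traceInner V X = v X := by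
  refine ⟨Matrix.of fun i j => v (Matrix.single i j 1), fun X => ?_⟩
  conv_rhs => rw [Matrix.matrix_eq_sum_single X]
  simp only [traceInner, Matrix.trace, Matrix.diag, Matrix.mul_apply, Matrix.transpose_apply,
    Matrix.of_apply, map_sum]
  rw [Finset.sum_comm]
  refine Finset.sum_congr rfl fun i _ => Finset.sum_congr rfl fun j _ => ?_
  rw [← mul_one (X i j), ← smul_eq_mul (X i j) 1, ← Matrix.smul_single, map_smul]
  simp [mul_comm]

end RankSparsity

theorem mainTheorem11 (n m : ℕ) (θ : ℝ) (hθ : 0 < θ) :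
    RankSparsity.FaciallyExposed (RankSparsity.rankSparsityBall n m θ) := by
  intro F hne hF
  -- Relative interiors are taken in a normed space; the choice of norm on matrices is immaterial.
  let : NormedAddCommGroup (Matrix (Fin n) (Fin m) ℝ) := Matrix.normedAddCommGroup
  let : NormedSpace ℝ (Matrix (Fin n) (Fin m) ℝ) := Matrix.normedSpace
  obtain ⟨v, hv⟩ := RankSparsity.IsFace.exists_eq_maximizers
    (RankSparsity.exists_isExposing_jointNorm hθ) hne hF
  obtain ⟨V, hV⟩ := RankSparsity.exists_traceInner_eq v
  exact ⟨V, by simp only [hV]; exact hv⟩
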